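/- In one-sided online bipartite matching, an input of size $n$ is a bipartite graph with $n$ online vertices and a finite offline side. The algorithm is deterministic and knows $n$ and the offline side in advance. The online vertices arrive one at a time; each is revealed together with its set of offline neighbours, and must irrevocably be rejected or matched to a neighbour that is still unmatched. The decision may depend on everything seen so far. A max-of-$k$ algorithm consists of $k$ such online algorithms run in parallel; its value is the size of the largest of the $k$ matchings. A width-$k$ algorithm maintains a set of partial solutions, initially only the empty one. Whenever an online vertex arrives, each maintained partial solution is continued by one or more possible decisions on that vertex (so branching is allowed at any time, but no partial solution may be discarded), and at every time, on every input, at most $k$ partial solutions are maintained. Its value $v(\mathbb A,I)$ on an input $I$ is the size of the largest matching maintained at the end. Let $v(I)$ be the size of a maximum matching of $I$. The asymptotic approximation ratio of $\mathbb A$ is $\liminf_{n\to\infty}\inf_{I} v(\mathbb A,I)/v(I)$, where the infimum is over all inputs $I$ of size $n$ with $v(I)>0$. **Theorem.** Let $k$ be a constant. 1. Every width-$k$ online bipartite matching algorithm has asymptotic approximation ratio at most $1/2$. 2. More precisely, there is a constant $c_k$, depending only on $k$, such that for every $n$ and every max-of-$k$ algorithm there is an input with $n$ online and $n$ offline vertices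 that has a perfect matching and on which the value of the algorithm is at most $n/2+c_k$. The same holds for every width-$k$ algorithm. -/

import Mathlib

open scoped ENNReal

namespace OnlineMatching

/-- An input of one-sided online bipartite matching with `n` online and `m` offline vertices: `G i`
is the set of neighbours of the `i`-th online vertex, and the online vertices arrive in the order
of `Fin n`. Its size, the number of data items, is `n`. -/
abbrev Input (n m : ℕ) : Type := Fin n → Finset (Fin m)

/-- The edge set `S` is a matching of `G`: it consists of pairwise vertex-disjoint edges of `G`. -/
def IsMatching {n m : ℕ} (G : Input n m) (S : Finset (Fin n × Fin m)) : Prop :=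
  (∀ e ∈ S, e.2 ∈ G e.1) ∧ ∀ e ∈ S, ∀ f ∈ S, e ≠ f → e.1 ≠ f.1 ∧ e.2 ≠ f.2

/-- The optimal value: the largest number of edges of a matching of `G`. -/
noncomputable def opt {n m : ℕ} (G : Input n m) : ℕ :=
  open Classical in
  ((Finset.univ : Finset (Finset (Fin n × Fin m))).filter (IsMatching G)).sup Finset.card

/-- `G` has a matching that covers all the vertices of both sides. -/
def HasPerfectMatching {n m : ℕ} (G : Input n m) : Prop :=
  ∃ σ : Fin n ≃ Fin m, ∀ i, σ i ∈ G i

/-- A partial solution: the decisions on the online vertices seen so far, **latest first**. The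
decision `some v` matches the online vertex to `v`, and `none` rejects it. -/
abbrev Partial (m : ℕ) : Type := List (Option (Fin m))

/-- The offline vertices matched by a partial solution. -/
abbrev Partial.used {m : ℕ} (M : Partial m) : List (Fin m) := M.reduceOption

/-- The number of edges of the matching given by a partial solution. -/
def Partial.size {m : ℕ} (M : Partial m) : ℕ := M.used.length

/-- The data items seen so far, **latest first**. -/
abbrev History (m : ℕ) : Type := List (Finset (Fin m))

/-- All the data items of an input, latest first. -/
def Input.history {n m : ℕ} (G : Input n m) : History m := (List.ofFn G).reverse

/-- The decision `d` on an online vertex with neighbour set `N` is possible after the partial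
solution `M`: either reject, or match to a neighbour that is still unmatched. -/
def Legal {m : ℕ} (N : Finset (Fin m)) (M : Partial m) (d : Option (Fin m)) : Prop :=
  ∀ v, d = some v → v ∈ N ∧ v ∉ M.used

/-- A deterministic online algorithm (for a fixed offline side `Fin m`, known in advance): the
decision on the current item `N` depends on the earlier items and on the earlier decisions. -/
structure OnlineAlgorithm (m : ℕ) where
  decide : History m → Finset (Fin m) → Partial m → Option (Fin m)
  legal : ∀ past N M, Legal N M (decide past N M)

/-- The decisions made by an online algorithm on the given data items. -/
def OnlineAlgorithm.run {m : ℕ} (A : OnlineAlgorithm m) : History m → Partial m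
  | [] => []
  | N :: past => A.decide past N (A.run past) :: A.run past

/-- The value of a max-of-`k` algorithm, that is, of `k` online algorithms run in parallel: the
size of the largest of their `k` matchings. -/
def maxOfValue {n m k : ℕ} (A : Fin k → OnlineAlgorithm m) (G : Input n m) : ℕ :=
  Finset.univ.sup fun j => ((A j).run G.history).size

/-- A deterministic branching online algorithm without cuts: when an item `N` arrives, each current
partial solution `M` is continued by all the decisions in `branch past N M`, of which there is at
least one. (The other current partial solutions are determined by the items seen.) -/
structure BranchingAlgorithm (m : ℕ) where
  branch : History m → Finset (Fin m) → Partial m → Finset (Option (Fin m))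
  no_cut : ∀ past N M, (branch past N M).Nonempty
  legal : ∀ past N M, ∀ d ∈ branch past N M, Legal N M d

/-- The level of the solution tree reached after the given data items: the set of the partial
solutions maintained at that time. The root, at level `0`, is the empty solution. -/
def BranchingAlgorithm.level {m : ℕ} (A : BranchingAlgorithm m) : History m → Finset (Partial m)
  | [] => {[]}
  | N :: past => (A.level past).biUnion fun M => (A.branch past N M).image fun d => d :: M

/-- On inputs with `n` data items, the solution tree has at most `k` nodes in each level: the
algorithm is a width-`k` algorithm for inputs of size `n`. -/
def BranchingAlgorithm.HasWidth {m : ℕ} (A : BranchingAlgorithm m) (n k : ℕ) : Prop :=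
  ∀ past : History m, past.length ≤ n → (A.level past).card ≤ k

/-- The value of a branching algorithm: the size of the largest matching in the last level. -/
def BranchingAlgorithm.value {n m : ℕ} (A : BranchingAlgorithm m) (G : Input n m) : ℕ :=
  (A.level G.history).sup Partial.size

/-- The asymptotic approximation ratio of an algorithm which knows the number `n` of data items and
the offline side: the limit inferior, as `n → ∞`, of the infimum of value / optimum over the inputs
of size `n` (with any number `m` of offline vertices) for which this quotient is defined. -/
noncomputable def asymptoticRatio (A : ℕ → (m : ℕ) → BranchingAlgorithm m) : ℝ≥0∞ :=
  Filter.liminf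
    (fun n : ℕ => ⨅ (m : ℕ) (G : Input n m) (_ : 0 < opt G),
      ((A n m).value G : ℝ≥0∞) / (opt G : ℝ≥0∞))
    Filter.atTop

end OnlineMatching

namespace OnlineMatching

open Finset Filter

/-! An adaptive adversary builds the graph together with a perfect matching, reserving a vertex `w`
for each item. Call an offline vertex free in a solution if it is neither reserved nor matched
there. While more than `2 ^ k * k` vertices are free in some solution, pigeonhole gives more than
`k` unreserved vertices that are unmatched in exactly the same solutions. These form the next item,
and some `w` among them is chosen by no solution. A solution that gains an edge thus loses two free
vertices, so `2 * size + #free` never exceeds its initial value `m` (`exists_balanced_item`). The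
few remaining vertices arrive as singletons and contribute only a constant. Only legality and the
width bound matter, so both models are treated at once. -/

/-- A family of sets of partial solutions, indexed by histories, which starts with the empty
solution and in which each solution is obtained from an earlier one by a legal decision. -/
structure IsSolutionFamily {m : ℕ} (F : History m → Finset (Partial m)) : Prop where
  root : ∀ M ∈ F [], M = []
  step : ∀ past N, ∀ M' ∈ F (N :: past), ∃ M ∈ F past, ∃ d, Legal N M d ∧ M' = d :: M

theorem BranchingAlgorithm.isSolutionFamily_level {m : ℕ} (A : BranchingAlgorithm m) :
    IsSolutionFamily A.level where
  root M hM := by simpa [BranchingAlgorithm.level] using hM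
  step past N M' hM' := by
    simp only [BranchingAlgorithm.level, mem_biUnion, mem_image] at hM'
    obtain ⟨M, hM, d, hd, rfl⟩ := hM'
    exact ⟨M, hM, d, A.legal past N M d hd, rfl⟩

theorem isSolutionFamily_run {m k : ℕ} (A : Fin k → OnlineAlgorithm m) :
    IsSolutionFamily fun past => univ.image fun j => (A j).run past where
  root M hM := by
    obtain ⟨j, -, rfl⟩ := mem_image.1 hM
    rfl
  step past N M' hM' := by
    obtain ⟨j, -, rfl⟩ := mem_image.1 hM'
    exact ⟨(A j).run past, mem_image_of_mem _ (mem_univ j), _, (A j).legal past N _, rfl⟩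

/-! ### Effect of one decision on size and free vertices -/

@[simp] theorem Partial.size_none_cons {m : ℕ} (M : Partial m) :
    Partial.size (none :: M) = M.size := by
  simp [Partial.size, Partial.used]

@[simp] theorem Partial.size_some_cons {m : ℕ} (v : Fin m) (M : Partial m) :
    Partial.size (some v :: M) = M.size + 1 := by
  simp [Partial.size, Partial.used]

/-- The vertices outside of `W` that are not matched by the partial solution `M`. -/
def freeVertices {m : ℕ} (W : List (Fin m)) (M : Partial m) : Finset (Fin m) :=
  univ.filter fun v => v ∉ W ∧ v ∉ M.used

theorem mem_freeVertices {m : ℕ} {W : List (Fin m)} {M : Partial m} {v : Fin m} :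
    v ∈ freeVertices W M ↔ v ∉ W ∧ v ∉ M.used := by
  simp [freeVertices]

theorem freeVertices_none_cons {m : ℕ} (w : Fin m) (W : List (Fin m)) (M : Partial m) :
    freeVertices (w :: W) (none :: M) = (freeVertices W M).erase w := by
  ext v
  simp [mem_freeVertices, Partial.used, and_assoc]

theorem freeVertices_some_cons {m : ℕ} (u w : Fin m) (W : List (Fin m)) (M : Partial m) :
    freeVertices (w :: W) (some u :: M) = ((freeVertices W M).erase w).erase u := by
  ext v
  simp only [mem_freeVertices, Partial.used, List.reduceOption_cons_of_some, List.mem_cons,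
    mem_erase]
  tauto

/-! ### Partially built perfect matchings -/

/-- `W` assigns distinct neighbours to the data items `L`. -/
def IsAssignment {m : ℕ} (L : History m) (W : List (Fin m)) : Prop :=
  W.Nodup ∧ List.Forall₂ (fun w N => w ∈ N) W L

theorem IsAssignment.nil {m : ℕ} : IsAssignment (m := m) [] [] :=
  ⟨List.nodup_nil, List.Forall₂.nil⟩

theorem IsAssignment.cons {m : ℕ} {L : History m} {W : List (Fin m)} (h : IsAssignment L W)
    {N : Finset (Fin m)} {w : Fin m} (hw : w ∈ N) (hW : w ∉ W) :
    IsAssignment (N :: L) (w :: W) :=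
  ⟨List.nodup_cons.2 ⟨hW, h.1⟩, List.Forall₂.cons hw h.2⟩

theorem IsAssignment.length_eq {m : ℕ} {L : History m} {W : List (Fin m)}
    (h : IsAssignment L W) : W.length = L.length :=
  h.2.length_eq

theorem IsAssignment.length_le {m : ℕ} {L : History m} {W : List (Fin m)}
    (h : IsAssignment L W) : L.length ≤ m := by
  rw [← h.length_eq]
  simpa using h.1.length_le_card

theorem IsAssignment.length_lt {m : ℕ} {L : History m} {W : List (Fin m)}
    (h : IsAssignment L W) {w : Fin m} (hw : w ∉ W) : L.length < m :=
  (h.cons (mem_univ w) hw).length_le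

/-- A property of assignments that holds for the starting pair holds for some pair from which no
extension by one item has it. -/
theorem IsAssignment.exists_maximal {m : ℕ} (P : History m → List (Fin m) → Prop)
    {L₀ : History m} {W₀ : List (Fin m)} (h₀ : IsAssignment L₀ W₀) (hP₀ : P L₀ W₀) :
    ∃ L W, IsAssignment L W ∧ P L W ∧
      ∀ N, ∀ w ∈ N, w ∉ W → ¬ P (N :: L) (w :: W) := by
  induction hd : m - L₀.length using Nat.strong_induction_on generalizing L₀ W₀ with
  | _ d ih =>
    by_cases hmax : ∀ N, ∀ w ∈ N, w ∉ W₀ → ¬ P (N :: L₀) (w :: W₀)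
    · exact ⟨L₀, W₀, h₀, hP₀, hmax⟩
    · push Not at hmax
      obtain ⟨N, w, hwN, hwW, hP⟩ := hmax
      have hlt := h₀.length_lt hwW
      exact ih (m - (N :: L₀).length) (by simp only [List.length_cons]; omega)
        (h₀.cons hwN hwW) hP rfl

/-! ### The adversary -/

/-- If many unassigned vertices are free in some maintained solution, then some neighbour set `N`
and assigned vertex `w ∈ N` do not increase the potential `2 * size + #free` of any solution. -/
theorem exists_balanced_item {m k : ℕ} {F : History m → Finset (Partial m)}
    (hF : IsSolutionFamily F) (hk : ∀ past : History m, past.length ≤ m → (F past).card ≤ k)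
    {L : History m} {W : List (Fin m)} (hLW : IsAssignment L W)
    (hbal : ∀ M ∈ F L, 2 * M.size + (freeVertices W M).card ≤ m)
    (hmany : 2 ^ k * k < ((F L).biUnion (freeVertices W)).card) :
    ∃ N, ∃ w ∈ N, w ∉ W ∧
      ∀ M ∈ F (N :: L), 2 * M.size + (freeVertices (w :: W) M).card ≤ m := by
  classical
  -- The type of `v` records which solutions leave it unmatched; there are at most `2 ^ k` types.
  set type : Fin m → Finset (Partial m) := fun v => (F L).filter fun M => v ∉ M.used
  obtain ⟨T, -, hT⟩ : ∃ T ∈ (F L).powerset,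
      k < (((F L).biUnion (freeVertices W)).filter fun v => type v = T).card := by
    apply exists_lt_card_fiber_of_mul_lt_card_of_maps_to
    · exact fun v _ => mem_powerset.2 (filter_subset _ _)
    · refine lt_of_le_of_lt ?_ hmany
      rw [card_powerset]
      exact Nat.mul_le_mul_right k (Nat.pow_le_pow_right two_pos (hk L hLW.length_le))
  set N := ((F L).biUnion (freeVertices W)).filter fun v => type v = T with hN
  have hNW : ∀ v ∈ N, v ∉ W := fun v hv => by
    obtain ⟨M, -, hM⟩ := mem_biUnion.1 (mem_filter.1 hv).1
    exact (mem_freeVertices.1 hM).1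
  obtain ⟨u, hu⟩ : N.Nonempty := card_pos.1 (by omega)
  -- At most `k` solutions exist after the item, so their latest decisions cannot cover all of `N`.
  obtain ⟨w, hwN, hw⟩ : ∃ w ∈ N, ∀ M ∈ F (N :: L), M.head? ≠ some (some w) := by
    by_contra! h
    have hsub : N.image (fun w => some (some w)) ⊆ (F (N :: L)).image List.head? := by
      intro x hx
      obtain ⟨w, hw, rfl⟩ := mem_image.1 hx
      exact mem_image.2 (h w hw)
    have h1 := card_le_card hsub
    rw [card_image_of_injective _ fun a b hab => by simpa using hab] at h1
    have h2 := hk (N :: L) (hLW.length_lt (hNW u hu))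
    have h3 := card_image_le (s := F (N :: L)) (f := List.head?)
    omega
  refine ⟨N, w, hwN, hNW w hwN, fun M' hM' => ?_⟩
  have hhead := hw M' hM'
  obtain ⟨M, hM, d, hd, rfl⟩ := hF.step L N M' hM'
  have hb := hbal M hM
  rcases d with _ | v
  · rw [Partial.size_none_cons, freeVertices_none_cons]
    have := card_erase_le (s := freeVertices W M) (a := w)
    omega
  · obtain ⟨hvN, hvM⟩ := hd v rfl
    have hvw : v ≠ w := fun h => hhead (by simp [h])
    -- Equal types: since `v` was unmatched in `M`, so is `w`, and both cease to be free.
    have hwM : w ∉ M.used := by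
      have : M ∈ type w := by
        rw [(mem_filter.1 hwN).2, ← (mem_filter.1 hvN).2]
        exact mem_filter.2 ⟨hM, hvM⟩
      exact (mem_filter.1 this).2
    have hwfree : w ∈ freeVertices W M := mem_freeVertices.2 ⟨hNW w hwN, hwM⟩
    have hvfree : v ∈ (freeVertices W M).erase w :=
      mem_erase.2 ⟨hvw, mem_freeVertices.2 ⟨hNW v hvN, hvM⟩⟩
    rw [Partial.size_some_cons, freeVertices_some_cons]
    have h1 := card_erase_add_one hwfree
    have h2 := card_erase_add_one hvfree
    omega

/-- An item with a single neighbour does not increase `size + #free` of any solution. -/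
theorem singleton_item_le {m C : ℕ} {F : History m → Finset (Partial m)}
    (hF : IsSolutionFamily F) {L : History m} {W : List (Fin m)} {w : Fin m} (hw : w ∉ W)
    (h : ∀ M ∈ F L, 2 * M.size + 2 * (freeVertices W M).card ≤ C) :
    ∀ M ∈ F ({w} :: L), 2 * M.size + 2 * (freeVertices (w :: W) M).card ≤ C := by
  intro M' hM'
  obtain ⟨M, hM, d, hd, rfl⟩ := hF.step L {w} M' hM'
  have hb := h M hM
  rcases d with _ | v
  · rw [Partial.size_none_cons, freeVertices_none_cons]
    have := card_erase_le (s := freeVertices W M) (a := w)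
    omega
  · obtain ⟨hvw, hvM⟩ := hd v rfl
    obtain rfl := mem_singleton.1 hvw
    rw [Partial.size_some_cons, freeVertices_some_cons, erase_idem]
    have h1 := card_erase_add_one (mem_freeVertices.2 ⟨hw, hvM⟩)
    omega

/-- Two maximality arguments replace the two phases of the adversary's play. -/
theorem exists_hard_history {m k : ℕ} {F : History m → Finset (Partial m)}
    (hF : IsSolutionFamily F) (hk : ∀ past : History m, past.length ≤ m → (F past).card ≤ k) :
    ∃ L W, IsAssignment L W ∧ L.length = m ∧ ∀ M ∈ F L, 2 * M.size ≤ m + 2 ^ k * k := by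
  obtain ⟨L₁, W₁, hLW₁, hbal, hmax₁⟩ := IsAssignment.exists_maximal
    (fun L W => ∀ M ∈ F L, 2 * M.size + (freeVertices W M).card ≤ m) IsAssignment.nil (by
      intro M hM
      obtain rfl := hF.root M hM
      have := card_le_univ (freeVertices [] ([] : Partial m))
      simpa [Partial.size, Partial.used] using this)
  have hfew : ((F L₁).biUnion (freeVertices W₁)).card ≤ 2 ^ k * k := by
    by_contra! h
    obtain ⟨N, w, hwN, hwW, hN⟩ := exists_balanced_item hF hk hLW₁ hbal h
    exact hmax₁ N w hwN hwW hN
  obtain ⟨L, W, hLW, hle, hmax⟩ := IsAssignment.exists_maximal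
    (fun L W => ∀ M ∈ F L, 2 * M.size + 2 * (freeVertices W M).card ≤ m + 2 ^ k * k) hLW₁ (by
      intro M hM
      have h1 := hbal M hM
      -- Doubling the weight of the free vertices costs at most `2 ^ k * k`.
      have h2 := card_le_card (subset_biUnion_of_mem (freeVertices W₁) hM)
      omega)
  refine ⟨L, W, hLW, ?_, fun M hM => by have := hle M hM; omega⟩
  have hall : ∀ w, w ∈ W := fun w => by
    by_contra hw
    exact hmax {w} w (mem_singleton_self w) hw (singleton_item_le hF hw hle)
  rw [← hLW.length_eq, ← List.toFinset_card_of_nodup hLW.1,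
    (eq_univ_iff_forall (s := W.toFinset)).2 fun w => List.mem_toFinset.2 (hall w), card_univ,
    Fintype.card_fin]

/-! ### From histories to inputs and ratios -/

theorem IsAssignment.exists_input {n : ℕ} {L : History n} {W : List (Fin n)}
    (h : IsAssignment L W) (hL : L.length = n) :
    ∃ G : Input n n, G.history = L ∧ HasPerfectMatching G := by
  have hLr : L.reverse.length = n := by simp [hL]
  have hWr : W.reverse.length = n := by simp [h.length_eq, hL]
  refine ⟨fun i => L.reverse.get (i.cast hLr.symm), ?_, ?_⟩
  · rw [Input.history, List.reverse_eq_iff]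
    apply List.ext_get
    · simp [hL]
    · intro i h1 h2
      simp
  · have hinj : Function.Injective fun i : Fin n => W.reverse.get (i.cast hWr.symm) :=
      (List.nodup_iff_injective_get.1 (List.nodup_reverse.2 h.1)).comp (Fin.cast_injective _)
    refine ⟨Equiv.ofBijective _ (Finite.injective_iff_bijective.1 hinj), fun i => ?_⟩
    have hr : List.Forall₂ (fun w N => w ∈ N) W.reverse L.reverse := List.rel_reverse h.2
    exact hr.get _ _

theorem exists_hard_input {n k : ℕ} {F : History n → Finset (Partial n)}
    (hF : IsSolutionFamily F) (hk : ∀ past : History n, past.length ≤ n → (F past).card ≤ k) :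
    ∃ G : Input n n, HasPerfectMatching G ∧
      (((F G.history).sup Partial.size : ℕ) : ℝ) ≤ (n : ℝ) / 2 + (2 ^ k * k : ℕ) := by
  obtain ⟨L, W, hLW, hL, hsize⟩ := exists_hard_history hF hk
  obtain ⟨G, rfl, hG⟩ := hLW.exists_input hL
  refine ⟨G, hG, ?_⟩
  have h : 2 * (F G.history).sup Partial.size ≤ n + 2 * (2 ^ k * k) := by
    have : (F G.history).sup Partial.size ≤ (n + 2 ^ k * k) / 2 :=
      Finset.sup_le fun M hM => by have := hsize M hM; omega
    omega
  have h' : (2 : ℝ) * ((F G.history).sup Partial.size : ℕ) ≤ n + 2 * (2 ^ k * k : ℕ) := by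
    exact_mod_cast h
  linarith

theorem BranchingAlgorithm.exists_hard_input {n k : ℕ} (A : BranchingAlgorithm n)
    (hA : A.HasWidth n k) :
    ∃ G : Input n n, HasPerfectMatching G ∧
      (A.value G : ℝ) ≤ (n : ℝ) / 2 + (2 ^ k * k : ℕ) :=
  OnlineMatching.exists_hard_input A.isSolutionFamily_level hA

theorem exists_hard_input_maxOf {n k : ℕ} (A : Fin k → OnlineAlgorithm n) :
    ∃ G : Input n n, HasPerfectMatching G ∧
      (maxOfValue A G : ℝ) ≤ (n : ℝ) / 2 + (2 ^ k * k : ℕ) := by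
  obtain ⟨G, hG, h⟩ := exists_hard_input (k := k) (isSolutionFamily_run A) fun past _ => by
    simpa using card_image_le (s := (univ : Finset (Fin k))) (f := fun j => (A j).run past)
  refine ⟨G, hG, ?_⟩
  rwa [sup_image] at h

theorem HasPerfectMatching.le_opt {n m : ℕ} {G : Input n m} (hG : HasPerfectMatching G) :
    n ≤ opt G := by
  classical
  obtain ⟨σ, hσ⟩ := hG
  have hinj : Function.Injective fun i => (i, σ i) := fun i j h => (Prod.ext_iff.1 h).1
  have hS : IsMatching G (univ.image fun i => (i, σ i)) := by
    refine ⟨fun e he => ?_, fun e he f hf hne => ?_⟩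
    · obtain ⟨i, -, rfl⟩ := mem_image.1 he
      exact hσ i
    · obtain ⟨i, -, rfl⟩ := mem_image.1 he
      obtain ⟨j, -, rfl⟩ := mem_image.1 hf
      have hij : i ≠ j := fun h => hne (by rw [h])
      exact ⟨hij, σ.injective.ne hij⟩
  have hcard : (univ.image fun i => (i, σ i)).card = n := by
    rw [card_image_of_injective _ hinj, card_univ, Fintype.card_fin]
  refine hcard.ge.trans ?_
  unfold opt
  exact Finset.le_sup (f := Finset.card) (mem_filter.2 ⟨mem_univ _, hS⟩)

/-- With `m = n`, the hard input has optimum at least `n`, so the quotient is at most `1 / 2 + c /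
n`. -/
theorem asymptoticRatio_le_half {c : ℕ} (A : ℕ → (m : ℕ) → BranchingAlgorithm m)
    (h : ∀ n, ∃ G : Input n n, HasPerfectMatching G ∧
      ((A n n).value G : ℝ) ≤ (n : ℝ) / 2 + c) :
    asymptoticRatio A ≤ 1 / 2 := by
  have hlim : Tendsto (fun n : ℕ => ENNReal.ofReal (1 / 2 + (c : ℝ) / n)) atTop
      (nhds (1 / 2)) := by
    have h1 : Tendsto (fun n : ℕ => 1 / 2 + (c : ℝ) / n) atTop (nhds (1 / 2)) := by
      simpa only [add_zero] using
        (tendsto_const_div_atTop_nhds_zero_nat (c : ℝ)).const_add (1 / 2)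
    have h2 : ENNReal.ofReal (1 / 2) = 1 / 2 := by
      rw [ENNReal.ofReal_div_of_pos two_pos]
      simp
    exact h2 ▸ ENNReal.tendsto_ofReal h1
  rw [← hlim.liminf_eq]
  refine liminf_le_liminf ?_
  filter_upwards [eventually_gt_atTop 0] with n hn
  obtain ⟨G, hG, hval⟩ := h n
  have hopt : n ≤ opt G := hG.le_opt
  refine (iInf₂_le_of_le n G (iInf_le _ (hn.trans_le hopt))).trans ?_
  have hn' : (0 : ℝ) < n := by exact_mod_cast hn
  calc ((A n n).value G : ℝ≥0∞) / (opt G : ℝ≥0∞)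
      ≤ ((A n n).value G : ℝ≥0∞) / (n : ℝ≥0∞) :=
        ENNReal.div_le_div_left (by exact_mod_cast hopt) _
    _ = ENNReal.ofReal (((A n n).value G : ℝ) / n) := by
        rw [ENNReal.ofReal_div_of_pos hn', ENNReal.ofReal_natCast, ENNReal.ofReal_natCast]
    _ ≤ ENNReal.ofReal (1 / 2 + (c : ℝ) / n) := by
        apply ENNReal.ofReal_le_ofReal
        rw [div_le_iff₀ hn', add_mul, div_mul_cancel₀ _ hn'.ne']
        linarith

end OnlineMatching

theorem mainTheorem3 (k : ℕ) :
    -- the asymptotic approximation ratio of every width-`k` algorithm is at most `1/2`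
    (∀ A : ℕ → (m : ℕ) → OnlineMatching.BranchingAlgorithm m,
      (∀ n m, (A n m).HasWidth n k) → OnlineMatching.asymptoticRatio A ≤ 1 / 2) ∧
    -- `n / 2 + c` for max-of-`k` and for width-`k` algorithms, with `c` depending only on `k`
    ∃ c : ℕ, ∀ n : ℕ,
      (∀ A : Fin k → OnlineMatching.OnlineAlgorithm n,
        ∃ G : OnlineMatching.Input n n, OnlineMatching.HasPerfectMatching G ∧
          (OnlineMatching.maxOfValue A G : ℝ) ≤ (n : ℝ) / 2 + c) ∧
      (∀ A : OnlineMatching.BranchingAlgorithm n, A.HasWidth n k →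
        ∃ G : OnlineMatching.Input n n, OnlineMatching.HasPerfectMatching G ∧
          (A.value G : ℝ) ≤ (n : ℝ) / 2 + c) := by
  exact ⟨fun A hA => OnlineMatching.asymptoticRatio_le_half A
      fun n => (A n n).exists_hard_input (hA n n),
    2 ^ k * k, fun n => ⟨OnlineMatching.exists_hard_input_maxOf,
      fun A hA => A.exists_hard_input hA⟩⟩
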